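/- Let $\tau>0$, let $\lambda,\gamma,\eta\in\mathbb C$ with $\lambda=a+ib$, $a,b\in\mathbb R$, $a\le \frac1\tau$, and let $\mathbb C_-=\{s\in\mathbb C:\operatorname{Re}s<0\}$, $\mathbb D_r=\{z\in\mathbb C:|z|<r\}$, and $\operatorname{Arg}\in(-\pi,\pi]$ the principal argument. Define $\Lambda_{\tau,a}\subset\mathbb C$ as follows. For $a<0$, $$\Lambda_{\tau,a}=\Big\{\eta\in\mathbb C\setminus\mathbb D_{|a|}:\ \operatorname{Re}\eta+a<0,\ |\eta|<|\eta_\pi|,\ |\operatorname{Arg}\eta|>\tau\sqrt{|\eta|^2-a^2}+\arctan\Big(-\tfrac1a\sqrt{|\eta|^2-a^2}\Big)\Big\}\cup\mathbb D_{|a|},$$ where $\eta_\pi$ is such that $\tau\sqrt{|\eta_\pi|^2-a^2}+\arctan\big(-\tfrac1a\sqrt{|\eta_\pi|^2-a^2}\big)=\pi$. For $a=0$, $$\Lambda_{\tau,0}=\Big\{\eta\in\mathbb C\setminus\{0\}:\ \operatorname{Re}\eta<0,\ |\eta|<\tfrac{\pi}{2\tau},\ |\operatorname{Arg}\eta|>\tau|\eta|+\tfrac{\pi}{2}\Big\}.$$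 For $0<a\le\frac1\tau$, $$\Lambda_{\tau,a}=\Big\{\eta\in\mathbb C:\ \operatorname{Re}\eta+a<0,\ |\eta|<|\eta_\pi|,\ |\operatorname{Arg}\eta|>\tau\sqrt{|\eta|^2-a^2}+\arctan\Big(-\tfrac1a\sqrt{|\eta|^2-a^2}\Big)+\pi\Big\},$$ where $\eta_\pi$ is such that $|\eta_\pi|>a$ and $\tau\sqrt{|\eta_\pi|^2-a^2}+\arctan\big(-\tfrac1a\sqrt{|\eta_\pi|^2-a^2}\big)=0$. (For $a=\frac1\tau$ no such $\eta_\pi$ exists, and $\Lambda_{\tau,a}=\emptyset$.) Then: (i) every solution $s\in\mathbb C$ of $s-a-\eta e^{-s\tau}=0$ belongs to $\mathbb C_-$ if and only if $\eta\in\Lambda_{\tau,a}$; (ii) every solution of $s-\lambda-\gamma e^{-s\tau}=0$ and every solution of its version with conjugate coefficients, $s-\overline\lambda-\overline\gamma e^{-s\tau}=0$, belongs to $\mathbb C_-$ if and only if $\gamma e^{-ib\tau}\in\Lambda_{\tau,a}$. Moreover, the same equivalence holds for each of these two equations separately. In particular, $\gamma e^{-ib\tau}\in\Lambda_{\tau,a}$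 is necessary and sufficient for stability of $x'(t)=\lambda x(t)+\gamma x(t-\tau)$, where stability means that all roots of the characteristic equation $s-\lambda-\gamma e^{-s\tau}=0$ have negative real parts. -/

import Mathlib

/-- The open left half-plane `ℂ₋ = {s : Re s < 0}`. -/
def leftHalfPlane : Set ℂ := {s | s.re < 0}

/-- The region `Λ_{τ,a}` for `a < 0`. The number `ηpi` is any complex number solving the displayed
equation; its modulus is determined by the equation. -/
noncomputable def LambdaNeg (τ a : ℝ) : Set ℂ :=
  {η : ℂ | η ∉ Metric.ball (0 : ℂ) |a| ∧ η.re + a < 0 ∧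
      (∃ ηpi : ℂ,
        Real.sqrt (‖ηpi‖ ^ 2 - a ^ 2) * τ
          + Real.arctan (-(1 / a) * Real.sqrt (‖ηpi‖ ^ 2 - a ^ 2)) = Real.pi ∧
        ‖η‖ < ‖ηpi‖) ∧
      |η.arg| > τ * Real.sqrt (‖η‖ ^ 2 - a ^ 2)
        + Real.arctan (-(1 / a) * Real.sqrt (‖η‖ ^ 2 - a ^ 2))}
    ∪ Metric.ball (0 : ℂ) |a|

/-- The region `Λ_{τ,0}`. -/
noncomputable def LambdaZero (τ : ℝ) : Set ℂ :=
  {η : ℂ | η ≠ 0 ∧ η.re < 0 ∧ ‖η‖ < Real.pi / (2 * τ) ∧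
      |η.arg| > τ * ‖η‖ + Real.pi / 2}

/-- The region `Λ_{τ,a}` for `0 < a ≤ 1/τ`. The modulus of `ηpi` is determined by the two
conditions on it; for `a = 1/τ` there is no such `ηpi`, and the region is empty. -/
noncomputable def LambdaPos (τ a : ℝ) : Set ℂ :=
  {η : ℂ | η.re + a < 0 ∧
      (∃ ηpi : ℂ, a < ‖ηpi‖ ∧
        Real.sqrt (‖ηpi‖ ^ 2 - a ^ 2) * τ
          + Real.arctan (-(1 / a) * Real.sqrt (‖ηpi‖ ^ 2 - a ^ 2)) = 0 ∧
        ‖η‖ < ‖ηpi‖) ∧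
      |η.arg| > τ * Real.sqrt (‖η‖ ^ 2 - a ^ 2)
        + Real.arctan (-(1 / a) * Real.sqrt (‖η‖ ^ 2 - a ^ 2)) + Real.pi}

/-- The region `Λ_{τ,a}`, for `τ > 0` and `a ≤ 1/τ`. -/
noncomputable def Lambda (τ a : ℝ) : Set ℂ :=
  if a < 0 then LambdaNeg τ a else if a = 0 then LambdaZero τ else LambdaPos τ a

/-- Stability of `x'(t) = lam * x(t) + γ * x(t - τ)`, in the sense that every characteristic root,
i.e. every complex solution of `s - lam - γ * exp (-s τ) = 0`, has negative real part. -/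
def DelayStable (τ : ℝ) (lam γ : ℂ) : Prop :=
  ∀ s : ℂ, s - lam - γ * Complex.exp (-s * (τ : ℂ)) = 0 → s ∈ leftHalfPlane

/-! Write r = |η|. A root s with Re s = σ satisfies |s - a| = r exp(-στ), so by conjugation symmetry
one may take Im s ≥ 0, and then σ alone determines s. Since η = (s - a) exp(sτ), the argument of η
must be `rootPhase` at σ, modulo 2π.

For r ≥ |a|, r > 0 and aτ ≤ 1, this phase is continuous and nonincreasing for σ ≥ 0, reaching 0
where s - a becomes a positive real. So the phases of roots with σ ≥ 0 fill [0, `rootPhase` at 0],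
and stability means |Arg η| > `rootPhase` at 0. If r < |a|, the equation is stable for a < 0 by size
alone, and unstable for a > 0 by a shift to the case r = a.

Rewriting arccos(-a/r) as an arctangent gives the inequality defining Λ; its bounds on Re η and |η|
then follow from that inequality. A vertical shift of s removes b. -/

/-- The argument of `s - a` for the point `s` of real part `σ` in the closed upper half-plane with
`‖s - a‖ = r * exp (-σ τ)`, when there is such a point. -/
noncomputable def rootAngle (τ a r σ : ℝ) : ℝ :=
  Real.arccos ((σ - a) / (r * Real.exp (-(σ * τ))))

/-- The argument (modulo `2π`) that `η`, of modulus `r`, must have for `s - a = η * exp (-s τ)` to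
have a solution of real part `σ` and nonnegative imaginary part. -/
noncomputable def rootPhase (τ a r σ : ℝ) : ℝ :=
  τ * (r * Real.exp (-(σ * τ)) * Real.sin (rootAngle τ a r σ)) + rootAngle τ a r σ

/-! ### The phase function and its monotonicity -/

lemma continuous_rootAngle {τ a r : ℝ} (hr : 0 < r) : Continuous (rootAngle τ a r) := by
  unfold rootAngle
  refine Real.continuous_arccos.comp ?_
  refine Continuous.div (by fun_prop) (by fun_prop) fun σ => ?_
  positivity

lemma continuous_rootPhase {τ a r : ℝ} (hr : 0 < r) : Continuous (rootPhase τ a r) := by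
  have := continuous_rootAngle (τ := τ) (a := a) hr
  unfold rootPhase
  fun_prop

lemma sin_rootAngle_nonneg (τ a r σ : ℝ) : 0 ≤ Real.sin (rootAngle τ a r σ) :=
  Real.sin_nonneg_of_nonneg_of_le_pi (Real.arccos_nonneg _) (Real.arccos_le_pi _)

lemma rootPhase_nonneg {τ r : ℝ} (hτ : 0 < τ) (hr : 0 < r) (a σ : ℝ) :
    0 ≤ rootPhase τ a r σ := by
  have h1 := sin_rootAngle_nonneg τ a r σ
  have h2 : 0 ≤ rootAngle τ a r σ := Real.arccos_nonneg _
  unfold rootPhase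
  positivity

lemma rootPhase_zero {τ a r : ℝ} (hr : 0 < r) :
    rootPhase τ a r 0 = τ * Real.sqrt (r ^ 2 - a ^ 2) + Real.arccos (-a / r) := by
  have h : r * Real.sqrt (1 - (-a / r) ^ 2) = Real.sqrt (r ^ 2 - a ^ 2) := by
    have h1 : r ^ 2 - a ^ 2 = r ^ 2 * (1 - (-a / r) ^ 2) := by field_simp
    rw [h1, Real.sqrt_mul (by positivity), Real.sqrt_sq hr.le]
  simp only [rootPhase, rootAngle, Real.sin_arccos, zero_mul, neg_zero, Real.exp_zero, mul_one,
    zero_sub, h]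

/-- For a > 0, r exp(-tτ) ≥ a exp(-tτ) > a(1 - tτ) ≥ a - t. This is where aτ ≤ 1 enters: it keeps
the argument of the arccosine above -1. -/
lemma sub_lt_mul_exp {τ a r t : ℝ} (hτ : 0 < τ) (ha : a * τ ≤ 1) (hr : 0 < r) (har : |a| ≤ r)
    (ht : 0 < t) : a - t < r * Real.exp (-(t * τ)) := by
  rcases le_or_gt a 0 with h | h
  · have : 0 < r * Real.exp (-(t * τ)) := by positivity
    linarith
  · have h1 : -(t * τ) + 1 < Real.exp (-(t * τ)) :=
      Real.add_one_lt_exp (by have : 0 < t * τ := by positivity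
                              linarith)
    have h2 : a * Real.exp (-(t * τ)) ≤ r * Real.exp (-(t * τ)) :=
      mul_le_mul_of_nonneg_right ((le_abs_self a).trans har) (Real.exp_pos _).le
    have h3 : a * (-(t * τ) + 1) < a * Real.exp (-(t * τ)) := mul_lt_mul_of_pos_left h1 h
    nlinarith

/-- With ω = Im s, the derivative collapses to -(τ²ω + (1 + τ(t - a))²/ω), whose sign is visible. -/
lemma hasDerivAt_rootPhase {τ a r t : ℝ} (hr : 0 < r)
    (h1 : a - t < r * Real.exp (-(t * τ))) (h2 : t - a < r * Real.exp (-(t * τ))) :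
    HasDerivAt (rootPhase τ a r)
      (-(τ ^ 2 * (r * Real.exp (-(t * τ)) * Real.sin (rootAngle τ a r t)) +
        (1 + τ * (t - a)) ^ 2 / (r * Real.exp (-(t * τ)) * Real.sin (rootAngle τ a r t)))) t := by
  have hR : 0 < r * Real.exp (-(t * τ)) := by positivity
  have hu1 : -1 < (t - a) / (r * Real.exp (-(t * τ))) := by
    rw [lt_div_iff₀ hR]; linarith
  have hu2 : (t - a) / (r * Real.exp (-(t * τ))) < 1 := by
    rw [div_lt_iff₀ hR]; linarith
  have hE : HasDerivAt (fun σ : ℝ => r * Real.exp (-(σ * τ)))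
      (r * (Real.exp (-(t * τ)) * -(1 * τ))) t :=
    ((((hasDerivAt_id t).mul_const τ).neg).exp).const_mul r
  have hU := ((hasDerivAt_id t).sub_const a).div hE hR.ne'
  have hA : HasDerivAt (rootAngle τ a r) _ t :=
    (Real.hasDerivAt_arccos hu1.ne' hu2.ne).comp t hU
  have hP : HasDerivAt (rootPhase τ a r) _ t := ((hE.mul hA.sin).const_mul τ).add hA
  convert hP using 1
  have hcos : Real.cos (rootAngle τ a r t) = (t - a) / (r * Real.exp (-(t * τ))) :=
    Real.cos_arccos hu1.le hu2.le
  have hsin : Real.sin (rootAngle τ a r t) =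
      Real.sqrt (1 - ((t - a) / (r * Real.exp (-(t * τ)))) ^ 2) := Real.sin_arccos _
  have hspos : 0 < Real.sin (rootAngle τ a r t) := by
    rw [hsin]; apply Real.sqrt_pos.2; nlinarith
  simp only [id_eq]
  rw [← hsin, hcos]
  generalize Real.sin (rootAngle τ a r t) = S at hspos ⊢
  have hEp := Real.exp_pos (-(t * τ))
  generalize Real.exp (-(t * τ)) = E at *
  field_simp
  ring

lemma rootPhase_le_rootPhase_zero {τ a r σ : ℝ} (hτ : 0 < τ) (ha : a * τ ≤ 1) (hr : 0 < r)
    (har : |a| ≤ r) (hσ : 0 ≤ σ) (h : σ - a ≤ r * Real.exp (-(σ * τ))) :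
    rootPhase τ a r σ ≤ rootPhase τ a r 0 := by
  have hd : ∀ t ∈ interior (Set.Icc 0 σ), HasDerivAt (rootPhase τ a r)
      (-(τ ^ 2 * (r * Real.exp (-(t * τ)) * Real.sin (rootAngle τ a r t)) +
        (1 + τ * (t - a)) ^ 2 / (r * Real.exp (-(t * τ)) * Real.sin (rootAngle τ a r t)))) t := by
    intro t ht
    rw [interior_Icc] at ht
    refine hasDerivAt_rootPhase hr (sub_lt_mul_exp hτ ha hr har ht.1) ?_
    have : r * Real.exp (-(σ * τ)) ≤ r * Real.exp (-(t * τ)) := by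
      have := ht.2.le
      gcongr
    linarith [ht.2]
  refine antitoneOn_of_deriv_nonpos (convex_Icc 0 σ) (continuous_rootPhase hr).continuousOn
    (fun t ht => (hd t ht).differentiableAt.differentiableWithinAt) (fun t ht => ?_)
    (Set.left_mem_Icc.2 hσ) (Set.right_mem_Icc.2 hσ) hσ
  rw [(hd t ht).deriv]
  have := sin_rootAngle_nonneg τ a r t
  rw [Left.neg_nonpos_iff]
  positivity

lemma polar_rootAngle {τ a r σ : ℝ} (hr : 0 < r) (h1 : a - σ ≤ r * Real.exp (-(σ * τ)))
    (h2 : σ - a ≤ r * Real.exp (-(σ * τ))) :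
    ((r * Real.exp (-(σ * τ)) : ℝ) : ℂ) * Complex.exp (rootAngle τ a r σ * Complex.I) =
      ⟨σ - a, r * Real.exp (-(σ * τ)) * Real.sin (rootAngle τ a r σ)⟩ := by
  have hR : 0 < r * Real.exp (-(σ * τ)) := by positivity
  have hcos : Real.cos (rootAngle τ a r σ) = (σ - a) / (r * Real.exp (-(σ * τ))) := by
    refine Real.cos_arccos ?_ ?_
    · rw [le_div_iff₀ hR]; linarith
    · rw [div_le_iff₀ hR]; linarith
  apply Complex.ext
  · rw [Complex.re_ofReal_mul, Complex.exp_ofReal_mul_I_re, hcos, mul_div_cancel₀ _ hR.ne']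
  · rw [Complex.im_ofReal_mul, Complex.exp_ofReal_mul_I_im]

/-! ### Instability: small argument or small modulus -/

lemma exists_root_of_le_rootPhase {τ a r θ : ℝ} (hτ : 0 < τ) (ha : a * τ ≤ 1) (hr : 0 < r)
    (har : |a| ≤ r) (hθ : 0 ≤ θ) (h : θ ≤ rootPhase τ a r 0) :
    ∃ s : ℂ, 0 ≤ s.re ∧
      s - a - (r * Complex.exp (θ * Complex.I)) * Complex.exp (-s * (τ : ℂ)) = 0 := by
  -- At σ₂ the point s - a is real and positive, so the phase vanishes there and the intermediate
  -- value theorem covers every θ up to the phase at 0.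
  obtain ⟨σ₂, hσ₂, hroot⟩ : ∃ σ ∈ Set.Icc 0 (|a| + r), σ - a - r * Real.exp (-(σ * τ)) = 0 := by
    have hc : Continuous fun σ : ℝ => σ - a - r * Real.exp (-(σ * τ)) := by fun_prop
    refine intermediate_value_Icc (by positivity) hc.continuousOn ⟨?_, ?_⟩
    · simp only [zero_mul, neg_zero, Real.exp_zero]
      linarith [neg_abs_le a]
    · have : Real.exp (-((|a| + r) * τ)) ≤ 1 := Real.exp_le_one_iff.2 (by
        have : 0 ≤ (|a| + r) * τ := by positivity
        linarith)
      nlinarith [le_abs_self a]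
  have h2 : rootPhase τ a r σ₂ = 0 := by
    have hR : r * Real.exp (-(σ₂ * τ)) ≠ 0 := by positivity
    have : rootAngle τ a r σ₂ = 0 := by
      rw [rootAngle, sub_eq_zero.1 hroot, div_self hR, Real.arccos_one]
    simp [rootPhase, this]
  obtain ⟨σ, hσ, hph⟩ := intermediate_value_Icc' hσ₂.1
    (continuous_rootPhase (τ := τ) (a := a) hr).continuousOn ⟨h2.le.trans hθ, h⟩
  have hlow : a - σ ≤ r * Real.exp (-(σ * τ)) := by
    rcases hσ.1.eq_or_lt with h0 | h0
    · rw [← h0]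
      simp only [zero_mul, neg_zero, Real.exp_zero]
      linarith [le_abs_self a]
    · exact (sub_lt_mul_exp hτ ha hr har h0).le
  have hup : σ - a ≤ r * Real.exp (-(σ * τ)) := by
    have : r * Real.exp (-(σ₂ * τ)) ≤ r * Real.exp (-(σ * τ)) := by
      have := hσ.2
      gcongr
    linarith [hσ.2]
  have hpol := polar_rootAngle hr hlow hup
  set ω : ℝ := r * Real.exp (-(σ * τ)) * Real.sin (rootAngle τ a r σ) with hω
  refine ⟨⟨σ, ω⟩, hσ.1, ?_⟩
  have e1 : (⟨σ, ω⟩ : ℂ) - a = ⟨σ - a, ω⟩ := by apply Complex.ext <;> simp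
  have e2 : (⟨σ, ω⟩ : ℂ) = σ + ω * Complex.I := Complex.mk_eq_add_mul_I _ _
  have e3 : θ = τ * ω + rootAngle τ a r σ := by rw [← hph, rootPhase]
  rw [e1, ← hpol, e2, e3, sub_eq_zero]
  push_cast
  rw [mul_assoc, mul_assoc, ← Complex.exp_add, ← Complex.exp_add]
  congr 2
  ring

lemma abs_arg_conj (z : ℂ) : |((starRingEnd ℂ) z).arg| = |z.arg| := by
  rw [Complex.arg_conj]
  split_ifs with h
  · rw [h]
  · rw [abs_neg]

lemma conj_root {τ : ℝ} {lam γ s : ℂ}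
    (h : s - lam - γ * Complex.exp (-s * (τ : ℂ)) = 0) :
    (starRingEnd ℂ) s - (starRingEnd ℂ) lam -
      (starRingEnd ℂ) γ * Complex.exp (-(starRingEnd ℂ) s * (τ : ℂ)) = 0 := by
  have := congrArg (starRingEnd ℂ) h
  simpa [← Complex.exp_conj] using this

lemma delayStable_conj_iff {τ : ℝ} {lam γ : ℂ} :
    DelayStable τ ((starRingEnd ℂ) lam) ((starRingEnd ℂ) γ) ↔ DelayStable τ lam γ := by
  constructor
  · intro h s hs
    simpa [leftHalfPlane] using h _ (conj_root hs)
  · intro h s hs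
    have := conj_root hs
    simp only [Complex.conj_conj] at this
    simpa [leftHalfPlane] using h _ this

lemma not_delayStable_of_arg_le {τ a : ℝ} {η : ℂ} (hτ : 0 < τ) (ha : a * τ ≤ 1) (hη : η ≠ 0)
    (har : |a| ≤ ‖η‖) (h : |η.arg| ≤ rootPhase τ a ‖η‖ 0) : ¬ DelayStable τ a η := by
  have hr : 0 < ‖η‖ := norm_pos_iff.2 hη
  wlog harg : 0 ≤ η.arg generalizing η
  · rw [← delayStable_conj_iff, Complex.conj_ofReal]
    apply this
    · simpa using hη
    · simpa using har
    · rw [abs_arg_conj]; simpa using h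
    · simpa using hr
    · rw [Complex.arg_conj]
      split_ifs
      · exact Real.pi_pos.le
      · linarith
  rw [abs_of_nonneg harg] at h
  obtain ⟨s, hs, hroot⟩ := exists_root_of_le_rootPhase hτ ha hr har harg h
  rw [Complex.norm_mul_exp_arg_mul_I] at hroot
  intro hst
  exact absurd (hst s hroot) (not_lt.2 hs)

lemma rootPhase_zero_self {τ a : ℝ} (ha : 0 < a) : rootPhase τ a a 0 = Real.pi := by
  rw [rootPhase_zero ha, neg_div, div_self ha.ne']
  simp

/-- Substituting s + σ for s replaces a by a - σ and η by exp(-στ)η. Choose σ in [0, a] making the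
new modulus equal to a - σ; the phase at 0 is then π, which no argument exceeds. -/
lemma not_delayStable_of_norm_lt {τ a : ℝ} {η : ℂ} (hτ : 0 < τ) (ha : a * τ ≤ 1)
    (h : ‖η‖ < a) : ¬ DelayStable τ a η := by
  have ha0 : 0 < a := (norm_nonneg η).trans_lt h
  rcases eq_or_ne η 0 with rfl | hη
  · intro hst
    have := hst a (by simp)
    simp only [leftHalfPlane, Set.mem_ofPred_eq, Complex.ofReal_re] at this
    linarith
  have hr : 0 < ‖η‖ := norm_pos_iff.2 hη
  obtain ⟨σ, hσ, hroot⟩ : ∃ σ ∈ Set.Icc 0 a, σ - a + ‖η‖ * Real.exp (-(σ * τ)) = 0 := by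
    have hc : Continuous fun σ : ℝ => σ - a + ‖η‖ * Real.exp (-(σ * τ)) := by fun_prop
    refine intermediate_value_Icc ha0.le hc.continuousOn ⟨?_, ?_⟩
    · simp only [zero_mul, neg_zero, Real.exp_zero]
      linarith
    · have : 0 < ‖η‖ * Real.exp (-(a * τ)) := by positivity
      linarith
  have hE : 0 < ‖η‖ * Real.exp (-(σ * τ)) := by positivity
  have hn : ‖((Real.exp (-(σ * τ)) : ℝ) : ℂ) * η‖ = a - σ := by
    rw [norm_mul, Complex.norm_real, Real.norm_eq_abs, abs_of_pos (Real.exp_pos _)]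
    linarith
  have key : ¬ DelayStable τ ((a - σ : ℝ) : ℂ) (((Real.exp (-(σ * τ)) : ℝ) : ℂ) * η) := by
    refine not_delayStable_of_arg_le hτ (by nlinarith [hσ.1]) ?_ ?_ ?_
    · rw [← norm_pos_iff, hn]; linarith
    · rw [hn, abs_of_pos (by linarith)]
    · rw [hn, rootPhase_zero_self (by linarith)]
      exact Complex.abs_arg_le_pi _
  intro hst
  apply key
  intro s hs
  have h1 := hst (s + σ) (by
    rw [← hs]
    push_cast
    rw [show -(s + (σ : ℂ)) * τ = -(σ * τ) + -s * τ by ring, Complex.exp_add]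
    ring)
  simp only [leftHalfPlane, Set.mem_ofPred_eq, Complex.add_re, Complex.ofReal_re] at h1 ⊢
  linarith [hσ.1]

/-! ### Stability and the resulting criterion -/

lemma norm_sub_eq_of_root {τ : ℝ} {a η s : ℂ}
    (h : s - a - η * Complex.exp (-s * (τ : ℂ)) = 0) :
    ‖s - a‖ = ‖η‖ * Real.exp (-(s.re * τ)) := by
  rw [sub_eq_zero.1 h, norm_mul, Complex.norm_exp]
  simp

/-- A root with Re s ≥ 0 would give |s - a| ≥ -a > |η| ≥ |η| exp(-τ Re s), against equality of
moduli. -/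
lemma delayStable_of_norm_lt {τ a : ℝ} {η : ℂ} (hτ : 0 < τ) (h : ‖η‖ < -a) :
    DelayStable τ a η := by
  intro s hs
  by_contra hre
  simp only [leftHalfPlane, Set.mem_ofPred_eq, not_lt] at hre
  have h1 := norm_sub_eq_of_root hs
  have h2 : Real.exp (-(s.re * τ)) ≤ 1 := Real.exp_le_one_iff.2 (by
    have : 0 ≤ s.re * τ := by positivity
    linarith)
  have h3 := Complex.re_le_norm (s - a)
  simp only [Complex.sub_re, Complex.ofReal_re] at h3
  nlinarith [norm_nonneg η]

lemma delayStable_of_lt_arg {τ a : ℝ} {η : ℂ} (hτ : 0 < τ) (ha : a * τ ≤ 1) (hη : η ≠ 0)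
    (har : |a| ≤ ‖η‖) (h : rootPhase τ a ‖η‖ 0 < |η.arg|) : DelayStable τ a η := by
  have hr : 0 < ‖η‖ := norm_pos_iff.2 hη
  intro s hs
  by_contra hre
  simp only [leftHalfPlane, Set.mem_ofPred_eq, not_lt] at hre
  wlog him : 0 ≤ s.im generalizing η s
  · refine this (η := (starRingEnd ℂ) η) (s := (starRingEnd ℂ) s) ?_ ?_ ?_ ?_ ?_ ?_ ?_
    · simpa using hη
    · simpa using har
    · rw [abs_arg_conj]; simpa using h
    · simpa using hr
    · simpa using conj_root hs
    · simpa using hre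
    · simp only [Complex.conj_im]; linarith
  have hn := norm_sub_eq_of_root hs
  set R : ℝ := ‖η‖ * Real.exp (-(s.re * τ)) with hRdef
  have hR : 0 < R := by positivity
  have habs := Complex.abs_re_le_norm (s - a)
  rw [hn] at habs
  simp only [Complex.sub_re, Complex.ofReal_re] at habs
  have hb := abs_le.1 habs
  have hpol := polar_rootAngle (τ := τ) (a := a) (σ := s.re) hr (by linarith) hb.2
  rw [← hRdef] at hpol
  have hnpol := congrArg Complex.normSq hpol
  have hsim : R * Real.sin (rootAngle τ a ‖η‖ s.re) = s.im := by
    have hs0 := sin_rootAngle_nonneg τ a ‖η‖ s.re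
    have h1 : R ^ 2 = (s.re - a) ^ 2 + s.im ^ 2 := by
      rw [← hn, ← Complex.normSq_eq_norm_sq, Complex.normSq_apply]
      simp; ring
    have h2 : R ^ 2 = (s.re - a) ^ 2 + (R * Real.sin (rootAngle τ a ‖η‖ s.re)) ^ 2 := by
      rw [Complex.normSq_mul, Complex.normSq_eq_norm_sq (Complex.exp _),
        Complex.norm_exp_ofReal_mul_I, Complex.normSq_ofReal, Complex.normSq_mk] at hnpol
      linarith
    -- Both quantities are nonnegative, so equal squares suffice.
    refine (pow_left_inj₀ (by positivity) him two_ne_zero).1 (by linarith)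
  have hph : rootPhase τ a ‖η‖ s.re = τ * s.im + rootAngle τ a ‖η‖ s.re := by
    rw [rootPhase, ← hRdef, hsim]
  have hle := rootPhase_le_rootPhase_zero hτ ha hr har hre hb.2
  have hnn := rootPhase_nonneg hτ hr a s.re
  have hη' : η = (‖η‖ : ℂ) * Complex.exp (rootPhase τ a ‖η‖ s.re * Complex.I) := by
    have e1 : s - a = (R : ℂ) * Complex.exp (rootAngle τ a ‖η‖ s.re * Complex.I) := by
      rw [hpol, hsim]; apply Complex.ext <;> simp
    have e2 : η = (s - a) * Complex.exp (s * τ) := by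
      rw [sub_eq_zero.1 hs, mul_assoc, ← Complex.exp_add]; simp
    have e3 : s * τ = (s.re : ℂ) * τ + s.im * τ * Complex.I := by
      conv_lhs => rw [← Complex.re_add_im s]
      ring
    rw [hph]
    conv_lhs => rw [e2, e1, hRdef, e3]
    push_cast
    rw [mul_assoc, mul_assoc, ← Complex.exp_add, ← Complex.exp_add]
    congr 2
    ring
  have harg : η.arg = rootPhase τ a ‖η‖ s.re := by
    have hpi := Complex.abs_arg_le_pi η
    conv_lhs => rw [hη']
    rw [Complex.exp_mul_I]
    -- The phase is below |Arg η| ≤ π, so it is the principal argument, with no multiple of 2π to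
    -- add.
    exact Complex.arg_mul_cos_add_sin_mul_I hr ⟨by linarith [Real.pi_pos], by linarith⟩
  rw [harg, abs_of_nonneg hnn] at h
  linarith

lemma delayStable_iff {τ a : ℝ} {η : ℂ} (hτ : 0 < τ) (ha : a * τ ≤ 1) :
    DelayStable τ a η ↔
      ‖η‖ < -a ∨ (|a| ≤ ‖η‖ ∧ η ≠ 0 ∧ rootPhase τ a ‖η‖ 0 < |η.arg|) := by
  constructor
  · intro h
    by_contra! hc
    obtain ⟨hc1, hc2⟩ := hc
    rcases lt_or_ge ‖η‖ a with h1 | h1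
    · exact not_delayStable_of_norm_lt hτ ha h1 h
    · have har : |a| ≤ ‖η‖ := abs_le.2 ⟨by linarith, h1⟩
      rcases eq_or_ne η 0 with rfl | hη
      · have ha0 : a = 0 := by simpa using har
        have := h 0 (by simp [ha0])
        simp [leftHalfPlane] at this
      · exact not_delayStable_of_arg_le hτ ha hη har (hc2 har hη) h
  · rintro (h | ⟨h1, h2, h3⟩)
    · exact delayStable_of_norm_lt hτ h
    · exact delayStable_of_lt_arg hτ ha h2 h1 h3

/-! ### Matching the criterion with the regions Λ -/

lemma arccos_div_eq_arctan {c r : ℝ} (hc : 0 < c) (hr : 0 < r) :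
    Real.arccos (c / r) = Real.arctan (1 / c * Real.sqrt (r ^ 2 - c ^ 2)) := by
  rw [Real.arccos_eq_arctan (by positivity)]
  have h1 : r ^ 2 - c ^ 2 = r ^ 2 * (1 - (c / r) ^ 2) := by field_simp
  rw [h1, Real.sqrt_mul (by positivity), Real.sqrt_sq hr.le]
  congr 1
  field_simp

/-- Dropping the nonnegative square-root term leaves arccos(-a/|η|) < |Arg η|; taking cosines gives
Re η/|η| < -a/|η|. -/
lemma re_add_neg_of_lt_arg {τ a : ℝ} {η : ℂ} (hτ : 0 < τ) (hη : η ≠ 0) (har : |a| ≤ ‖η‖)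
    (h : rootPhase τ a ‖η‖ 0 < |η.arg|) : η.re + a < 0 := by
  have hr : 0 < ‖η‖ := norm_pos_iff.2 hη
  rw [rootPhase_zero hr] at h
  have h1 : Real.arccos (-a / ‖η‖) < |η.arg| := by
    have : 0 ≤ τ * Real.sqrt (‖η‖ ^ 2 - a ^ 2) := by positivity
    linarith
  have h2 := Real.cos_lt_cos_of_nonneg_of_le_pi (Real.arccos_nonneg _)
    (Complex.abs_arg_le_pi η) h1
  have hb := abs_le.1 har
  rw [Real.cos_abs, Real.cos_arccos (by rw [le_div_iff₀ hr]; linarith)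
    (by rw [div_le_iff₀ hr]; linarith), Complex.cos_arg hη,
    div_lt_div_iff_of_pos_right hr] at h2
  linarith

/-- Produces η_π: a value w beyond √(r² - a²) with g(w) = c comes from the intermediate value
theorem, and z = √(w² + a²) has the required modulus. Uniqueness of that modulus plays no role. -/
lemma exists_sqrt_eq {g : ℝ → ℝ} {a r L c : ℝ} (hg : Continuous g)
    (h1 : g (Real.sqrt (r ^ 2 - a ^ 2)) < c) (hL : Real.sqrt (r ^ 2 - a ^ 2) ≤ L)
    (h2 : c ≤ g L) (har : |a| ≤ r) :
    ∃ z : ℂ, g (Real.sqrt (‖z‖ ^ 2 - a ^ 2)) = c ∧ r < ‖z‖ := by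
  obtain ⟨w, hw, hgw⟩ := intermediate_value_Icc hL hg.continuousOn ⟨h1.le, h2⟩
  have hr : 0 ≤ r := (abs_nonneg a).trans har
  have hsq : a ^ 2 ≤ r ^ 2 := sq_le_sq.2 (by rwa [abs_of_nonneg hr])
  have hlt : Real.sqrt (r ^ 2 - a ^ 2) < w := by
    refine lt_of_le_of_ne hw.1 fun h => ?_
    rw [h] at h1
    exact h1.ne hgw
  have hw0 : 0 ≤ w := (Real.sqrt_nonneg _).trans hw.1
  have hn : ‖((Real.sqrt (w ^ 2 + a ^ 2) : ℝ) : ℂ)‖ = Real.sqrt (w ^ 2 + a ^ 2) := by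
    rw [Complex.norm_real, Real.norm_eq_abs, abs_of_nonneg (Real.sqrt_nonneg _)]
  refine ⟨(Real.sqrt (w ^ 2 + a ^ 2) : ℝ), ?_, ?_⟩
  · rw [hn, Real.sq_sqrt (by positivity), add_sub_cancel_right, Real.sqrt_sq hw0, hgw]
  · rw [hn]
    apply Real.lt_sqrt_of_sq_lt
    have := (Real.sqrt_lt' (lt_of_le_of_lt (Real.sqrt_nonneg _) hlt)).1 hlt
    linarith

lemma rootPhase_zero_of_neg {τ a r : ℝ} (ha : a < 0) (hr : 0 < r) :
    rootPhase τ a r 0 = τ * Real.sqrt (r ^ 2 - a ^ 2)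
      + Real.arctan (-(1 / a) * Real.sqrt (r ^ 2 - a ^ 2)) := by
  rw [rootPhase_zero hr, arccos_div_eq_arctan (neg_pos.2 ha) hr, neg_sq, div_neg]

lemma rootPhase_zero_of_pos {τ a r : ℝ} (ha : 0 < a) (hr : 0 < r) :
    rootPhase τ a r 0 = τ * Real.sqrt (r ^ 2 - a ^ 2)
      + Real.arctan (-(1 / a) * Real.sqrt (r ^ 2 - a ^ 2)) + Real.pi := by
  rw [rootPhase_zero hr, neg_div, Real.arccos_neg, arccos_div_eq_arctan ha hr, neg_mul,
    Real.arctan_neg]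
  ring

lemma mem_LambdaNeg_iff {τ a : ℝ} {η : ℂ} (hτ : 0 < τ) (ha : a < 0) :
    η ∈ LambdaNeg τ a ↔
      ‖η‖ < -a ∨ (|a| ≤ ‖η‖ ∧ η ≠ 0 ∧ rootPhase τ a ‖η‖ 0 < |η.arg|) := by
  simp only [LambdaNeg, Set.mem_union, Set.mem_ofPred_eq, mem_ball_zero_iff, not_lt]
  rw [or_comm, abs_of_neg ha]
  refine or_congr_right ?_
  constructor
  · rintro ⟨h1, -, -, h4⟩
    have hr : 0 < ‖η‖ := by linarith
    exact ⟨h1, norm_pos_iff.1 hr, by rwa [rootPhase_zero_of_neg ha hr]⟩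
  · rintro ⟨h1, hη, h3⟩
    have hr : 0 < ‖η‖ := by linarith
    have har : |a| ≤ ‖η‖ := by rwa [abs_of_neg ha]
    refine ⟨h1, re_add_neg_of_lt_arg hτ hη har h3, ?_, by rwa [rootPhase_zero_of_neg ha hr] at h3⟩
    rw [rootPhase_zero_of_neg ha hr] at h3
    have hpi := Complex.abs_arg_le_pi η
    have hW := Real.sqrt_nonneg (‖η‖ ^ 2 - a ^ 2)
    refine exists_sqrt_eq (g := fun w => w * τ + Real.arctan (-(1 / a) * w))
      -- Increasing w by π/τ adds π to wτ, enough to reach π since the arctangent is nonnegative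
      -- here.
      (L := Real.sqrt (‖η‖ ^ 2 - a ^ 2) + Real.pi / τ) (by fun_prop) ?_ ?_ ?_ har
    · linarith [mul_comm τ (Real.sqrt (‖η‖ ^ 2 - a ^ 2))]
    · have : 0 < Real.pi / τ := by positivity
      linarith
    · have h5 : 0 ≤ -(1 / a) := by
        have := one_div_neg.2 ha
        linarith
      have h6 : 0 ≤ Real.arctan
          (-(1 / a) * (Real.sqrt (‖η‖ ^ 2 - a ^ 2) + Real.pi / τ)) :=
        Real.arctan_nonneg.2 (by positivity)
      have h7 : (Real.sqrt (‖η‖ ^ 2 - a ^ 2) + Real.pi / τ) * τ =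
          Real.sqrt (‖η‖ ^ 2 - a ^ 2) * τ + Real.pi := by field_simp
      have h8 : 0 ≤ Real.sqrt (‖η‖ ^ 2 - a ^ 2) * τ := by positivity
      linarith

lemma mem_LambdaPos_iff {τ a : ℝ} {η : ℂ} (hτ : 0 < τ) (ha : 0 < a) :
    η ∈ LambdaPos τ a ↔
      ‖η‖ < -a ∨ (|a| ≤ ‖η‖ ∧ η ≠ 0 ∧ rootPhase τ a ‖η‖ 0 < |η.arg|) := by
  have h0 : ¬ ‖η‖ < -a := by linarith [norm_nonneg η]
  simp only [LambdaPos, Set.mem_ofPred_eq, h0, false_or, abs_of_pos ha]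
  constructor
  · rintro ⟨h1, -, h3⟩
    have h4 : a < ‖η‖ := by
      have := Complex.abs_re_le_norm η
      linarith [neg_abs_le η.re]
    have hr : 0 < ‖η‖ := by linarith
    exact ⟨h4.le, norm_pos_iff.1 hr, by rwa [rootPhase_zero_of_pos ha hr]⟩
  · rintro ⟨h1, hη, h3⟩
    have hr : 0 < ‖η‖ := by linarith
    have har : |a| ≤ ‖η‖ := by rwa [abs_of_pos ha]
    refine ⟨re_add_neg_of_lt_arg hτ hη har h3, ?_, by rwa [rootPhase_zero_of_pos ha hr] at h3⟩
    rw [rootPhase_zero_of_pos ha hr] at h3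
    have hpi := Complex.abs_arg_le_pi η
    have hW := Real.sqrt_nonneg (‖η‖ ^ 2 - a ^ 2)
    obtain ⟨z, hz1, hz2⟩ := exists_sqrt_eq (g := fun w => w * τ + Real.arctan (-(1 / a) * w))
      (L := Real.sqrt (‖η‖ ^ 2 - a ^ 2) + Real.pi / τ) (r := ‖η‖) (a := a) (c := 0)
      (by fun_prop)
      (by linarith [mul_comm τ (Real.sqrt (‖η‖ ^ 2 - a ^ 2))])
      (by have : 0 < Real.pi / τ := by positivity
          linarith)
      -- The same increment π outweighs an arctangent above -π/2.
      (by
        have h6 := Real.neg_pi_div_two_lt_arctan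
          (-(1 / a) * (Real.sqrt (‖η‖ ^ 2 - a ^ 2) + Real.pi / τ))
        have h7 : (Real.sqrt (‖η‖ ^ 2 - a ^ 2) + Real.pi / τ) * τ =
            Real.sqrt (‖η‖ ^ 2 - a ^ 2) * τ + Real.pi := by field_simp
        have h8 : 0 ≤ Real.sqrt (‖η‖ ^ 2 - a ^ 2) * τ := by positivity
        linarith [Real.pi_pos]) har
    exact ⟨z, by linarith, hz1, hz2⟩

lemma mem_LambdaZero_iff {τ : ℝ} {η : ℂ} (hτ : 0 < τ) :
    η ∈ LambdaZero τ ↔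
      ‖η‖ < -(0 : ℝ) ∨ (|(0 : ℝ)| ≤ ‖η‖ ∧ η ≠ 0 ∧ rootPhase τ 0 ‖η‖ 0 < |η.arg|) := by
  have h0 : ¬ ‖η‖ < -(0 : ℝ) := by simp
  have hph : η ≠ 0 → rootPhase τ 0 ‖η‖ 0 = τ * ‖η‖ + Real.pi / 2 := fun hη => by
    rw [rootPhase_zero (norm_pos_iff.2 hη)]
    simp
  simp only [LambdaZero, Set.mem_ofPred_eq, h0, false_or]
  constructor
  · rintro ⟨h1, -, -, h4⟩
    exact ⟨by simp, h1, by rwa [hph h1]⟩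
  · rintro ⟨h1, hη, h3⟩
    refine ⟨hη, by simpa using re_add_neg_of_lt_arg hτ hη h1 h3, ?_, by rwa [hph hη] at h3⟩
    rw [hph hη] at h3
    have hpi := Complex.abs_arg_le_pi η
    rw [lt_div_iff₀ (by positivity)]
    linarith

lemma delayStable_iff_mem_Lambda {τ a : ℝ} (hτ : 0 < τ) (ha : a ≤ 1 / τ) (η : ℂ) :
    DelayStable τ a η ↔ η ∈ Lambda τ a := by
  rw [delayStable_iff hτ ((le_div_iff₀ hτ).1 ha), Lambda]
  split_ifs with h1 h2
  · exact (mem_LambdaNeg_iff hτ h1).symm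
  · subst h2
    exact (mem_LambdaZero_iff hτ).symm
  · exact (mem_LambdaPos_iff hτ (lt_of_le_of_ne (not_lt.1 h1) (Ne.symm h2))).symm

/-- Translating s by ib leaves real parts unchanged and multiplies the delay coefficient by
exp(-ibτ). -/
lemma delayStable_shift_iff (τ a b : ℝ) (γ : ℂ) :
    DelayStable τ (a + Complex.I * b) γ ↔
      DelayStable τ a (γ * Complex.exp (-Complex.I * b * τ)) := by
  have key : ∀ s : ℂ, Complex.exp (-(s + Complex.I * b) * τ) =
      Complex.exp (-Complex.I * b * τ) * Complex.exp (-s * τ) := fun s => by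
    rw [← Complex.exp_add]; congr 1; ring
  constructor
  · intro h s hs
    have := h (s + Complex.I * b) (by rw [key, ← hs]; ring)
    simpa [leftHalfPlane] using this
  · intro h s hs
    have := h (s - Complex.I * b) (by
      rw [mul_assoc, ← key, sub_add_cancel, ← hs]; ring)
    simpa [leftHalfPlane] using this

theorem mainTheorem2 (τ : ℝ) (hτ : 0 < τ) (a b : ℝ) (ha : a ≤ 1 / τ) (lam γ η : ℂ)
    (hlam : lam = (a : ℂ) + Complex.I * (b : ℂ)) :
    -- (i)
    ((∀ s : ℂ, s - (a : ℂ) - η * Complex.exp (-s * (τ : ℂ)) = 0 → s ∈ leftHalfPlane) ↔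
      η ∈ Lambda τ a) ∧
    -- (ii)
    (((∀ s : ℂ, s - lam - γ * Complex.exp (-s * (τ : ℂ)) = 0 → s ∈ leftHalfPlane) ∧
        (∀ s : ℂ, s - (starRingEnd ℂ) lam - (starRingEnd ℂ) γ * Complex.exp (-s * (τ : ℂ)) = 0 →
          s ∈ leftHalfPlane)) ↔
      γ * Complex.exp (-Complex.I * (b : ℂ) * (τ : ℂ)) ∈ Lambda τ a) ∧
    -- each of the two delay equations on its own
    (DelayStable τ lam γ ↔ γ * Complex.exp (-Complex.I * (b : ℂ) * (τ : ℂ)) ∈ Lambda τ a) ∧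
    (DelayStable τ ((starRingEnd ℂ) lam) ((starRingEnd ℂ) γ) ↔
      γ * Complex.exp (-Complex.I * (b : ℂ) * (τ : ℂ)) ∈ Lambda τ a) := by
  subst hlam
  have h : DelayStable τ (a + Complex.I * b) γ ↔
      γ * Complex.exp (-Complex.I * (b : ℂ) * (τ : ℂ)) ∈ Lambda τ a :=
    (delayStable_shift_iff τ a b γ).trans (delayStable_iff_mem_Lambda hτ ha _)
  have hc := delayStable_conj_iff.trans h
  exact ⟨delayStable_iff_mem_Lambda hτ ha η,
    ⟨fun hs => h.1 hs.1, fun hm => ⟨h.2 hm, hc.2 hm⟩⟩, h, hc⟩
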